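/- **Coding Theorem.** Let $P \in \mathbb{Z}[a, z_1, \ldots, z_\nu]$ be a polynomial of total degree $\delta > 0$ (in all $\nu+1$ variables). For $i = (i_0, \ldots, i_\nu) \in \mathbb{N}^{\nu+1}$ let $P_i$ be the coefficient of $a^{i_0} z_1^{i_1} \cdots z_\nu^{i_\nu}$ in $P$, and put $|i| = i_0 + \cdots + i_\nu$ and $i! = i_0! \cdots i_\nu!$. Put $n_s = (\delta+1)^s$ and define $$\mathcal{L} = \sum_i |P_i|, \quad r = \min\{n \in \mathbb{N} : 4^n > 2\,\delta!\,\mathcal{L}\,(\nu+3)^\delta\}, \quad \beta = 4^r, \quad \alpha = \delta n_\nu + 1, \quad \gamma = \beta^{n_\nu},$$ the polynomials in $\mathbb{Z}[a,f]$ $$\mathfrak{b} = 1 + 3(2a+1)f, \quad \mathscr{B} = \beta\,\mathfrak{b}^\delta, \quad M = \sum_{j=0}^{n_\nu} m_j \mathscr{B}^j \ \text{ with } m_j = \begin{cases} \mathscr{B} - \mathfrak{b} & \text{if } j \in \{n_1, \ldots, n_\nu\},\\ \mathscr{B} - 1 & \text{otherwise,}\end{cases}$$ $$N_0 = \mathscr{B}^{n_\nu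 + 1}, \quad N_1 = 4\mathscr{B}^{(2\delta+1)n_\nu + 1}, \quad N = N_0 N_1, \quad \mathscr{T} = M + (\mathscr{B} - 2)\mathscr{B}^{n_{\nu+1}} N_0, \quad Y = N^2,$$ and the polynomials in $\mathbb{Z}[a,f,g]$ $$c = 1 + a\mathscr{B} + g, \qquad \mathscr{K} = c^\delta \sum_{|i| \le \delta} i!\,(\delta - |i|)!\,P_i\,\mathscr{B}^{\,n_{\nu+1} - \sum_{s=0}^{\nu} i_s n_s} + \sum_{j=0}^{(2\delta+1)n_\nu} \frac{\mathscr{B}}{2}\,\mathscr{B}^j,$$ $$\mathscr{S} = g + 2\mathscr{K}N_0, \qquad \mathscr{R} = (\mathscr{S} + \mathscr{T} + 1)N + \mathscr{T} + 1, \qquad X = (N-1)\mathscr{R}.$$ Write $[j,k) = \{n \in \mathbb{N} : j \le n < k\}$. Let $a, f \in \mathbb{N}$ with $f > 0$ be such that $\mathfrak{b} := \mathfrak{b}(a,f)$ is a power of two. Then $X(a,f,g) \ge 0$ for all $g \in [0, 2\gamma\mathfrak{b}^\alpha)$, and the following are equivalent: 1. there is $(z_1, \ldots, z_\nu) \in [0,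 \mathfrak{b})^\nu$, not identically zero, with $P(a, z_1, \ldots, z_\nu) = 0$; 2. there is $g \in [\mathfrak{b}, \gamma\mathfrak{b}^\alpha)$ such that $Y(a,f)$ divides $\binom{2X(a,f,g)}{X(a,f,g)}$. Moreover, if $Y(a,f)$ divides $\binom{2X(a,f,g)}{X(a,f,g)}$ for some $g \in [0, 2\gamma\mathfrak{b}^\alpha)$, then there is $(z_1, \ldots, z_\nu) \in [0, \mathfrak{b})^\nu$ (possibly zero) with $P(a, z_1, \ldots, z_\nu) = 0$. -/

import Mathlib

/-!
The variables of the Coding Theorem. Throughout, `P ∈ ℤ[a, z₁, …, z_ν]` is a polynomial over the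
index type `Fin (ν + 1)`: the variable `0` is the parameter `a`, and the variable `i` with
`1 ≤ i ≤ ν` is the unknown `z_i`. Elements of `ℤ[a, f]` and `ℤ[a, f, g]` are polynomials over
`Fin 2` and `Fin 3`, with the variables in this order.
-/

namespace Coding

open MvPolynomial

variable {ν : ℕ}

/-- `δ`, the total degree of `P` (in the parameter and the unknowns). -/
noncomputable def delta (P : MvPolynomial (Fin (ν + 1)) ℤ) : ℕ := P.totalDegree

/-- The positions `n_i = (δ + 1) ^ i`. -/
noncomputable def pos (P : MvPolynomial (Fin (ν + 1)) ℤ) (i : ℕ) : ℕ := (delta P + 1) ^ i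

/-- `ℒ`, the sum of the absolute values of the coefficients of `P`. -/
noncomputable def ell (P : MvPolynomial (Fin (ν + 1)) ℤ) : ℕ :=
  ∑ i ∈ P.support, (P.coeff i).natAbs

/-- `r`, the least natural number with `4 ^ r > 2 δ! ℒ (ν + 3) ^ δ`. -/
noncomputable def r (P : MvPolynomial (Fin (ν + 1)) ℤ) : ℕ :=
  sInf {n : ℕ | 2 * (delta P).factorial * ell P * (ν + 3) ^ delta P < 4 ^ n}

/-- `β = 4 ^ r`. -/
noncomputable def beta (P : MvPolynomial (Fin (ν + 1)) ℤ) : ℕ := 4 ^ r P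

/-- `α = δ n_ν + 1`. -/
noncomputable def alpha (P : MvPolynomial (Fin (ν + 1)) ℤ) : ℕ := delta P * pos P ν + 1

/-- `γ = β ^ n_ν`. -/
noncomputable def gamma (P : MvPolynomial (Fin (ν + 1)) ℤ) : ℕ := beta P ^ pos P ν

/-! ### Polynomials in `ℤ[a, f]` -/

/-- `𝔟 = 1 + 3 (2 a + 1) f`. -/
noncomputable def b : MvPolynomial (Fin 2) ℤ := 1 + 3 * (2 * X 0 + 1) * X 1

/-- `ℬ = β 𝔟 ^ δ`. -/
noncomputable def B (P : MvPolynomial (Fin (ν + 1)) ℤ) : MvPolynomial (Fin 2) ℤ :=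
  C (beta P : ℤ) * b ^ delta P

/-- `ℬ / 2`; the division is exact, since `β = 4 ^ r` with `r ≥ 1` whenever `P ≠ 0`. -/
noncomputable def halfB (P : MvPolynomial (Fin (ν + 1)) ℤ) : MvPolynomial (Fin 2) ℤ :=
  C ((beta P / 2 : ℕ) : ℤ) * b ^ delta P

open Classical in
/-- `M = ∑_{j = 0}^{n_ν} m_j ℬ ^ j`, where `m_j = ℬ - 𝔟` if `j = n_i` for some `1 ≤ i ≤ ν`, and
`m_j = ℬ - 1` otherwise. -/
noncomputable def M (P : MvPolynomial (Fin (ν + 1)) ℤ) : MvPolynomial (Fin 2) ℤ :=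
  ∑ j ∈ Finset.range (pos P ν + 1),
    (if ∃ i, 1 ≤ i ∧ i ≤ ν ∧ j = pos P i then B P - b else B P - 1) * B P ^ j

/-- `N₀ = ℬ ^ (n_ν + 1)`. -/
noncomputable def N0 (P : MvPolynomial (Fin (ν + 1)) ℤ) : MvPolynomial (Fin 2) ℤ :=
  B P ^ (pos P ν + 1)

/-- `N₁ = 4 ℬ ^ ((2 δ + 1) n_ν + 1)`. -/
noncomputable def N1 (P : MvPolynomial (Fin (ν + 1)) ℤ) : MvPolynomial (Fin 2) ℤ :=
  4 * B P ^ ((2 * delta P + 1) * pos P ν + 1)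

/-- `N = N₀ N₁`. -/
noncomputable def N (P : MvPolynomial (Fin (ν + 1)) ℤ) : MvPolynomial (Fin 2) ℤ := N0 P * N1 P

/-- `𝒯 = M + (ℬ - 2) ℬ ^ n_{ν+1} N₀`. -/
noncomputable def T (P : MvPolynomial (Fin (ν + 1)) ℤ) : MvPolynomial (Fin 2) ℤ :=
  M P + (B P - 2) * B P ^ pos P (ν + 1) * N0 P

/-- `Y = N ^ 2`. -/
noncomputable def Y (P : MvPolynomial (Fin (ν + 1)) ℤ) : MvPolynomial (Fin 2) ℤ := N P ^ 2

/-- `∑_i i₀! ⋯ i_ν! (δ - |i|)! P_i ℬ ^ (n_{ν+1} - ∑_s i_s n_s)`, summed over the exponents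
`i = (i₀, …, i_ν)` of the monomials of `P`, with `P_i` the coefficient of `P` at `i` and
`|i| = i₀ + ⋯ + i_ν`. As `|i| ≤ δ`, both subtractions have non-negative values. -/
noncomputable def coeffs (P : MvPolynomial (Fin (ν + 1)) ℤ) : MvPolynomial (Fin 2) ℤ :=
  ∑ i ∈ P.support,
    C (((∏ s, (i s).factorial) * (delta P - ∑ s, i s).factorial : ℕ) * P.coeff i) *
      B P ^ (pos P (ν + 1) - ∑ s : Fin (ν + 1), i s * pos P s)

/-! ### Polynomials in `ℤ[a, f, g]` -/

/-- The inclusion `ℤ[a, f] ⊆ ℤ[a, f, g]`. -/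
noncomputable def incl (p : MvPolynomial (Fin 2) ℤ) : MvPolynomial (Fin 3) ℤ :=
  rename Fin.castSucc p

/-- `c = 1 + a ℬ + g`. -/
noncomputable def c (P : MvPolynomial (Fin (ν + 1)) ℤ) : MvPolynomial (Fin 3) ℤ :=
  1 + X 0 * incl (B P) + X 2

/-- `𝒦 = c ^ δ coeffs(ℬ) + ∑_{j = 0}^{(2 δ + 1) n_ν} (ℬ / 2) ℬ ^ j`. -/
noncomputable def K (P : MvPolynomial (Fin (ν + 1)) ℤ) : MvPolynomial (Fin 3) ℤ :=
  c P ^ delta P * incl (coeffs P) +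
    ∑ j ∈ Finset.range ((2 * delta P + 1) * pos P ν + 1), incl (halfB P * B P ^ j)

/-- `𝒮 = g + 2 𝒦 N₀`. -/
noncomputable def S (P : MvPolynomial (Fin (ν + 1)) ℤ) : MvPolynomial (Fin 3) ℤ :=
  X 2 + 2 * K P * incl (N0 P)

/-- `ℛ = (𝒮 + 𝒯 + 1) N + 𝒯 + 1`. -/
noncomputable def R (P : MvPolynomial (Fin (ν + 1)) ℤ) : MvPolynomial (Fin 3) ℤ :=
  (S P + incl (T P) + 1) * incl (N P) + incl (T P) + 1

/-- `X = (N - 1) ℛ`. -/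
noncomputable def XX (P : MvPolynomial (Fin (ν + 1)) ℤ) : MvPolynomial (Fin 3) ℤ :=
  (incl (N P) - 1) * R P

/-! ### Values -/

/-- The integer `𝔟(a, f)`. -/
noncomputable def bVal (a f : ℕ) : ℤ := eval ![(a : ℤ), (f : ℤ)] b

/-- The integer `X(a, f, g)`. -/
noncomputable def XVal (P : MvPolynomial (Fin (ν + 1)) ℤ) (a f g : ℕ) : ℤ :=
  eval ![(a : ℤ), (f : ℤ), (g : ℤ)] (XX P)

/-- The integer `Y(a, f)`. -/
noncomputable def YVal (P : MvPolynomial (Fin (ν + 1)) ℤ) (a f : ℕ) : ℤ :=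
  eval ![(a : ℤ), (f : ℤ)] (Y P)

/-- The integer `P(a, z₁, …, z_ν)`. -/
noncomputable def PVal (P : MvPolynomial (Fin (ν + 1)) ℤ) (a : ℕ) (z : Fin ν → ℕ) : ℤ :=
  eval (Fin.cons (a : ℤ) (fun i => (z i : ℤ))) P

/-- `Y(a, f)` divides the binomial coefficient `C(2 X(a, f, g), X(a, f, g))`
(meaningful when `X(a, f, g) ≥ 0`). -/
def BinomCond (P : MvPolynomial (Fin (ν + 1)) ℤ) (a f g : ℕ) : Prop :=
  YVal P a f ∣ (((2 * (XVal P a f g).toNat).choose (XVal P a f g).toNat : ℕ) : ℤ)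

end Coding

namespace Coding

open MvPolynomial

variable {ν : ℕ}

/-! ### Binary digits -/

/-! Write `N = 2 ^ n` and let `S, T < N` be the values of `𝒮` and `𝒯`. Expanding the product gives
`X = (S + T) N ^ 2 + (N - 1 - S) N + (N - 1 - T)`. The 2-adic valuation of `C(2X, X)` is the binary
weight of `X`, which is `2 n + wt (S + T) - wt S - wt T`. So `N ^ 2` divides `C(2X, X)` exactly when
`S + T` produces no carry, i.e. `S &&& T = 0` (`sq_dvd_choose_iff`).

Cutting both numbers at `N₀`, a power of two, turns this into two conditions. First, `g &&& M = 0`: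
this says that `g = ∑ z_i ℬ ^ n_i` with all `z_i < 𝔟` (`land_mask_eq_zero_iff`). Second, `2𝒦` must
avoid the bits of `(ℬ - 2) ℬ ^ n_{ν+1}`. For such `g`, `c = 1 + a ℬ ^ n_0 + ∑ z_i ℬ ^ n_i`; the
monomials of `c ^ δ` sit at positions that determine their exponents in base `δ + 1`, so the
coefficient of `ℬ ^ n_{ν+1}` in `c ^ δ coeffs(ℬ)` pairs each monomial of `P` with its own value and
equals `δ! P(a, z)` (`kappa_pos_eq`). All coefficients are below `ℬ / 2` in absolute value, so
adding `ℬ / 2` to each yields genuine digits, and the second condition says that `ℬ / 2` divides `δ!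
P(a, z)`, i.e. that `P(a, z) = 0` (`two_mul_land_eq_zero_iff_PVal`). -/

/-- The number of ones in the binary expansion. -/
def binWeight (x : ℕ) : ℕ := (Nat.digits 2 x).sum

theorem binWeight_two_mul_add (x : ℕ) {i : ℕ} (hi : i < 2) :
    binWeight (2 * x + i) = binWeight x + i := by
  unfold binWeight
  rcases Nat.eq_zero_or_pos (2 * x + i) with h | h
  · have hx : x = 0 := by omega
    have h0 : i = 0 := by omega
    subst hx h0
    simp
  · rw [Nat.digits_def' (by norm_num) h, show (2 * x + i) % 2 = i by omega,
      show (2 * x + i) / 2 = x by omega, List.sum_cons, add_comm]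

theorem binWeight_zero : binWeight 0 = 0 := by simp [binWeight]

theorem binWeight_two_mul (x : ℕ) : binWeight (2 * x) = binWeight x :=
  binWeight_two_mul_add x (i := 0) (by norm_num)

theorem binWeight_add_two_pow_mul (n x y : ℕ) (hx : x < 2 ^ n) :
    binWeight (x + 2 ^ n * y) = binWeight x + binWeight y := by
  induction n generalizing x with
  | zero =>
    have : x = 0 := by simpa using hx
    simp [this, binWeight_zero]
  | succ n ih =>
    have h2 : x % 2 < 2 := Nat.mod_lt _ (by norm_num)
    have hx' : x / 2 < 2 ^ n := by rw [pow_succ] at hx; omega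
    have e1 : x + 2 ^ (n + 1) * y = 2 * (x / 2 + 2 ^ n * y) + x % 2 := by
      rw [pow_succ, mul_add, ← mul_assoc, mul_comm 2 (2 ^ n)]; omega
    have e2 : binWeight x = binWeight (x / 2) + x % 2 := by
      conv_lhs => rw [← Nat.div_add_mod x 2]
      exact binWeight_two_mul_add _ h2
    rw [e1, binWeight_two_mul_add _ h2, ih _ hx', e2]
    omega

theorem binWeight_compl (n x : ℕ) (hx : x < 2 ^ n) :
    binWeight (2 ^ n - 1 - x) + binWeight x = n := by
  induction n generalizing x with
  | zero =>
    have : x = 0 := by simpa using hx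
    simp [this, binWeight_zero]
  | succ n ih =>
    have h2 : x % 2 < 2 := Nat.mod_lt _ (by norm_num)
    have hx' : x / 2 < 2 ^ n := by rw [pow_succ] at hx; omega
    have e1 : 2 ^ (n + 1) - 1 - x = 2 * (2 ^ n - 1 - x / 2) + (1 - x % 2) := by
      rw [pow_succ] at hx ⊢; omega
    have e2 : binWeight x = binWeight (x / 2) + x % 2 := by
      conv_lhs => rw [← Nat.div_add_mod x 2]
      exact binWeight_two_mul_add _ h2
    rw [e1, binWeight_two_mul_add _ (by omega), e2]
    have := ih _ hx'
    omega

theorem land_add_two_pow_mul (n : ℕ) {x u : ℕ} (y v : ℕ) (hx : x < 2 ^ n) (hu : u < 2 ^ n) :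
    (x + 2 ^ n * y) &&& (u + 2 ^ n * v) = (x &&& u) + 2 ^ n * (y &&& v) := by
  apply Nat.eq_of_testBit_eq
  intro i
  rw [Nat.testBit_and, add_comm x, add_comm u, add_comm (x &&& u),
    Nat.testBit_two_pow_mul_add _ hx, Nat.testBit_two_pow_mul_add _ hu,
    Nat.testBit_two_pow_mul_add _ (Nat.and_lt_two_pow _ hu)]
  split <;> simp [Nat.testBit_and]

theorem land_add_two_pow_mul_eq_zero (n : ℕ) {x u : ℕ} (y v : ℕ) (hx : x < 2 ^ n)
    (hu : u < 2 ^ n) :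
    (x + 2 ^ n * y) &&& (u + 2 ^ n * v) = 0 ↔ x &&& u = 0 ∧ y &&& v = 0 := by
  rw [land_add_two_pow_mul n y v hx hu]
  have : 0 < 2 ^ n := by positivity
  simp

theorem binWeight_add_one_le (x : ℕ) : binWeight (x + 1) ≤ binWeight x + 1 := by
  induction x using Nat.strong_induction_on with
  | _ x ih =>
    rcases Nat.even_or_odd' x with ⟨y, rfl | rfl⟩
    · rw [binWeight_two_mul_add _ (by norm_num), binWeight_two_mul]
    · rw [show 2 * y + 1 + 1 = 2 * (y + 1) by ring, binWeight_two_mul,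
        binWeight_two_mul_add _ (by norm_num)]
      have := ih y (by omega)
      omega

/-- Binary weights add up exactly when there is no carry. -/
theorem binWeight_add (n x y : ℕ) (hx : x < 2 ^ n) (hy : y < 2 ^ n) :
    binWeight (x + y) ≤ binWeight x + binWeight y ∧
      (binWeight (x + y) = binWeight x + binWeight y ↔ x &&& y = 0) := by
  induction n generalizing x y with
  | zero =>
    have h1 : x = 0 := by simpa using hx
    have h2 : y = 0 := by simpa using hy
    simp [h1, h2, binWeight_zero]
  | succ n ih =>
    rw [pow_succ] at hx hy
    obtain ⟨s, i, hi, rfl⟩ : ∃ s i, i < 2 ∧ x = i + 2 ^ 1 * s :=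
      ⟨x / 2, x % 2, Nat.mod_lt _ (by norm_num), by omega⟩
    obtain ⟨t, j, hj, rfl⟩ : ∃ s i, i < 2 ∧ y = i + 2 ^ 1 * s :=
      ⟨y / 2, y % 2, Nat.mod_lt _ (by norm_num), by omega⟩
    obtain ⟨h1, h2⟩ := ih s t (by omega) (by omega)
    rw [land_add_two_pow_mul_eq_zero 1 s t (by omega) (by omega), ← h2, pow_one,
      add_comm i, add_comm j, binWeight_two_mul_add _ hi, binWeight_two_mul_add _ hj]
    -- Two low ones produce a carry: two ones are replaced by an increment, which adds at most one
    -- to the weight, so the inequality is strict.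
    by_cases hij : i = 1 ∧ j = 1
    · obtain ⟨rfl, rfl⟩ := hij
      rw [show 2 * s + 1 + (2 * t + 1) = 2 * (s + t + 1) by ring, binWeight_two_mul]
      have := binWeight_add_one_le (s + t)
      have h3 : (1 &&& 1 : ℕ) = 1 := by decide
      rw [h3]
      omega
    · have h3 : i &&& j = 0 := by interval_cases i <;> interval_cases j <;> simp_all
      rw [show 2 * s + i + (2 * t + j) = 2 * (s + t) + (i + j) by ring,
        binWeight_two_mul_add _ (by omega), h3]
      omega

/-- Legendre's formula gives `2 wt(x) - wt(2x)`, and doubling preserves the weight. -/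
theorem padicValNat_choose_two_mul (x : ℕ) :
    padicValNat 2 ((2 * x).choose x) = binWeight x := by
  have h := sub_one_mul_padicValNat_choose_eq_sub_sum_digits (p := 2) (k := x) (n := 2 * x)
    (by omega)
  have e : 2 * x - x = x := by omega
  have h2 := binWeight_two_mul x
  unfold binWeight at *
  rw [e] at h
  omega

/-- The divisibility `N ^ 2 ∣ C(2X, X)` detects that `S` and `T` have disjoint binary digits. -/
theorem sq_dvd_choose_iff (n S T : ℕ) (hS : S < 2 ^ n) (hT : T < 2 ^ n) :
    (2 ^ n) ^ 2 ∣ (2 * ((2 ^ n - 1 - T) + 2 ^ n * ((2 ^ n - 1 - S) + 2 ^ n * (S + T)))).choose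
      ((2 ^ n - 1 - T) + 2 ^ n * ((2 ^ n - 1 - S) + 2 ^ n * (S + T))) ↔ S &&& T = 0 := by
  set x := (2 ^ n - 1 - T) + 2 ^ n * ((2 ^ n - 1 - S) + 2 ^ n * (S + T)) with hx
  have hc : (2 * x).choose x ≠ 0 := (Nat.choose_pos (by omega)).ne'
  -- Only the two lower blocks have to be below `2 ^ n`; the top block `S + T` may overflow.
  have hw : binWeight x = binWeight (2 ^ n - 1 - T) + (binWeight (2 ^ n - 1 - S) +
      binWeight (S + T)) := by
    rw [hx, binWeight_add_two_pow_mul _ _ _ (by omega),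
      binWeight_add_two_pow_mul _ _ _ (by omega)]
  have h1 := binWeight_compl n S hS
  have h2 := binWeight_compl n T hT
  obtain ⟨h3, h4⟩ := binWeight_add n S T hS hT
  rw [← pow_mul, padicValNat_dvd_iff_le hc, padicValNat_choose_two_mul, ← h4]
  omega

/-! ### Digits to a base that is a power of two -/

theorem sum_mul_pow_lt {B : ℕ} (m : ℕ) (d : ℕ → ℕ) (hd : ∀ j < m, d j < B) :
    ∑ j ∈ Finset.range m, d j * B ^ j < B ^ m := by
  induction m with
  | zero => simp
  | succ m ih =>
    rw [Finset.sum_range_succ, pow_succ]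
    have h1 := ih fun j hj => hd j (by omega)
    have h2 : (d m + 1) * B ^ m ≤ B * B ^ m := Nat.mul_le_mul_right _ (hd m (by omega))
    rw [add_mul] at h2
    rw [mul_comm (B ^ m) B]
    omega

theorem sum_land_sum_eq_zero_iff (k m : ℕ) (d e : ℕ → ℕ) (hd : ∀ j < m, d j < 2 ^ k)
    (he : ∀ j < m, e j < 2 ^ k) :
    (∑ j ∈ Finset.range m, d j * (2 ^ k) ^ j) &&& (∑ j ∈ Finset.range m, e j * (2 ^ k) ^ j) = 0 ↔
      ∀ j < m, d j &&& e j = 0 := by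
  induction m with
  | zero => simp
  | succ m ih =>
    have h1 := sum_mul_pow_lt m d fun j hj => hd j (by omega)
    have h2 := sum_mul_pow_lt m e fun j hj => he j (by omega)
    rw [Finset.sum_range_succ, Finset.sum_range_succ, mul_comm (d m), mul_comm (e m)]
    rw [← pow_mul] at h1 h2 ⊢
    rw [land_add_two_pow_mul_eq_zero _ _ _ h1 h2,
      ih (fun j hj => hd j (by omega)) (fun j hj => he j (by omega)), Nat.forall_lt_succ_right]

theorem sum_digits_eq {B : ℕ} (m g : ℕ) (hg : g < B ^ m) :
    g = ∑ j ∈ Finset.range m, (g / B ^ j % B) * B ^ j := by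
  have : ∀ m, g % B ^ m = ∑ j ∈ Finset.range m, (g / B ^ j % B) * B ^ j := by
    intro m
    induction m with
    | zero => simp [Nat.mod_one]
    | succ m ih => rw [Finset.sum_range_succ, ← ih, Nat.mod_pow_succ, mul_comm (B ^ m)]
  rw [← this, Nat.mod_eq_of_lt hg]

theorem land_two_pow_sub_one_eq_zero {k d : ℕ} (hd : d < 2 ^ k) :
    d &&& (2 ^ k - 1) = 0 ↔ d = 0 := by
  rw [Nat.and_two_pow_sub_one_eq_mod, Nat.mod_eq_of_lt hd]

/-- The ones of `2 ^ k - 2 ^ q` are exactly the bits `q, …, k - 1`. -/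
theorem land_two_pow_sub_two_pow_eq_zero {k q d : ℕ} (hq : q ≤ k) (hd : d < 2 ^ k) :
    d &&& (2 ^ k - 2 ^ q) = 0 ↔ d < 2 ^ q := by
  obtain ⟨l, rfl⟩ := Nat.exists_eq_add_of_le hq
  have e : 2 ^ (q + l) - 2 ^ q = 0 + 2 ^ q * (2 ^ l - 1) := by
    rw [pow_add, Nat.mul_sub, mul_one, zero_add]
  have hdl : d / 2 ^ q < 2 ^ l := Nat.div_lt_of_lt_mul (by rwa [← pow_add])
  have hpos : 0 < 2 ^ q := by positivity
  conv_lhs => rw [e, ← Nat.mod_add_div d (2 ^ q)]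
  rw [land_add_two_pow_mul_eq_zero _ _ _ (Nat.mod_lt _ hpos) hpos,
    land_two_pow_sub_one_eq_zero hdl]
  simp [Nat.div_eq_zero_iff]

/-- The bits `1, …, k - 1` of the `n`-th digit of `2 ∑ d_j (2 ^ k) ^ j` are zero exactly when
`2 ^ (k - 1)` divides `d_n`. -/
theorem two_mul_land_eq_zero_iff {k m n : ℕ} (hk : 0 < k) (hn : n < m) (d : ℕ → ℕ)
    (hd : ∀ j < m, d j < 2 ^ k) :
    (2 * ∑ j ∈ Finset.range m, d j * (2 ^ k) ^ j) &&& ((2 ^ k - 2) * (2 ^ k) ^ n) = 0 ↔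
      2 ^ (k - 1) ∣ d n := by
  obtain ⟨l, rfl⟩ : ∃ l, k = l + 1 := ⟨k - 1, by omega⟩
  have hl : 0 < 2 ^ l := by positivity
  -- Both sides of the conjunction are even; halving them realigns the mask with the digits, as the
  -- single digit `2 ^ l - 1`.
  have e1 : (2 ^ (l + 1) - 2) * (2 ^ (l + 1)) ^ n =
      0 + 2 ^ 1 * (∑ j ∈ Finset.range m, (if j = n then 2 ^ l - 1 else 0) * (2 ^ (l + 1)) ^ j) := by
    rw [Finset.sum_eq_single n (by intro j _ h; simp [h]) (by intro h; simp at h; omega)]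
    rw [if_pos rfl, ← mul_assoc, zero_add, pow_succ 2 l, pow_one, Nat.mul_sub, mul_one,
      mul_comm 2 (2 ^ l)]
  have e2 : ∀ x, 2 * x = 0 + 2 ^ 1 * x := by simp
  rw [e1, e2, land_add_two_pow_mul_eq_zero 1 _ _ (by simp) (by simp)]
  rw [sum_land_sum_eq_zero_iff (l + 1) m _ _ hd]
  · simp only [Nat.and_self, true_and, Nat.add_sub_cancel]
    constructor
    · intro h
      have := h n hn
      rw [if_pos rfl, Nat.and_two_pow_sub_one_eq_mod] at this
      exact Nat.dvd_of_mod_eq_zero this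
    · intro h j _
      split_ifs with hj
      · rw [hj, Nat.and_two_pow_sub_one_eq_mod]
        exact Nat.mod_eq_zero_of_dvd h
      · simp
  · intro j _
    split_ifs
    · rw [pow_succ]; omega
    · positivity


/-! ### The digits of `𝒦` -/

theorem sum_mul_pow_injective {B n : ℕ} {x y : Fin n → ℕ} (hx : ∀ s, x s < B)
    (hy : ∀ s, y s < B) (h : ∑ s, x s * B ^ (s : ℕ) = ∑ s, y s * B ^ (s : ℕ)) : x = y := by
  induction n with
  | zero => exact Subsingleton.elim _ _
  | succ n ih =>
    have key : ∀ z : Fin (n + 1) → ℕ, ∑ s, z s * B ^ (s : ℕ) =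
        z 0 + B * ∑ s : Fin n, z s.succ * B ^ (s : ℕ) := by
      intro z
      rw [Fin.sum_univ_succ, Finset.mul_sum]
      simp only [Fin.val_zero, pow_zero, mul_one, Fin.val_succ, pow_succ]
      congr 1
      exact Finset.sum_congr rfl fun s _ => by ring
    rw [key, key] at h
    have hB : 0 < B := (Nat.zero_le _).trans_lt (hx 0)
    have h0 : x 0 = y 0 := by
      have := congrArg (· % B) h
      simpa [Nat.add_mul_mod_self_left, Nat.mod_eq_of_lt (hx 0), Nat.mod_eq_of_lt (hy 0)] using this
    have h1 : ∑ s : Fin n, x s.succ * B ^ (s : ℕ) = ∑ s : Fin n, y s.succ * B ^ (s : ℕ) := by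
      rw [h0] at h
      exact Nat.eq_of_mul_eq_mul_left hB (Nat.add_left_cancel h)
    have h2 := ih (x := fun s => x s.succ) (y := fun s => y s.succ)
      (fun s => hx _) (fun s => hy _) h1
    funext s
    refine Fin.cases h0 (fun t => congrFun h2 t) s

theorem sum_le_delta (P : MvPolynomial (Fin (ν + 1)) ℤ) {i : Fin (ν + 1) →₀ ℕ}
    (hi : i ∈ P.support) : ∑ s, i s ≤ delta P := by
  have := le_totalDegree hi
  rwa [Finsupp.sum_fintype _ _ (fun _ => rfl)] at this

theorem sum_mul_pos_le (P : MvPolynomial (Fin (ν + 1)) ℤ) {e : Fin (ν + 1) → ℕ}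
    (he : ∑ s, e s ≤ delta P) : ∑ s, e s * pos P s ≤ delta P * pos P ν := by
  refine le_trans ?_ (Nat.mul_le_mul_right _ he)
  rw [Finset.sum_mul]
  refine Finset.sum_le_sum fun s _ => Nat.mul_le_mul_left _ ?_
  exact Nat.pow_le_pow_right (by omega) (by omega)

theorem pos_succ (P : MvPolynomial (Fin (ν + 1)) ℤ) (s : ℕ) :
    pos P (s + 1) = delta P * pos P s + pos P s := by
  unfold pos
  ring

/-- The coefficient contributed to `𝒦` by the monomial `e` of `c ^ δ` and the monomial `i`
of `P`. -/
noncomputable def termCoeff (P : MvPolynomial (Fin (ν + 1)) ℤ) (w : Fin (ν + 1) → ℕ)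
    (p : (Fin (ν + 2) → ℕ) × (Fin (ν + 1) →₀ ℕ)) : ℤ :=
  (Nat.multinomial Finset.univ p.1 * ∏ s : Fin (ν + 1), w s ^ p.1 s.succ : ℕ) *
    (((∏ s, (p.2 s).factorial) * (delta P - ∑ s, p.2 s).factorial : ℕ) * P.coeff p.2)

/-- The position at which `termCoeff` contributes. -/
noncomputable def termPos (P : MvPolynomial (Fin (ν + 1)) ℤ)
    (p : (Fin (ν + 2) → ℕ) × (Fin (ν + 1) →₀ ℕ)) : ℕ :=
  (∑ s : Fin (ν + 1), p.1 s.succ * pos P s) + (pos P (ν + 1) - ∑ s, p.2 s * pos P s)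

/-- The pairs of monomials contributing to `𝒦`. -/
noncomputable def terms (P : MvPolynomial (Fin (ν + 1)) ℤ) :
    Finset ((Fin (ν + 2) → ℕ) × (Fin (ν + 1) →₀ ℕ)) :=
  (Finset.univ.piAntidiag (delta P)) ×ˢ P.support

/-- The `j`-th coefficient of `c ^ δ coeffs(ℬ)`, as a polynomial in `ℬ`. -/
noncomputable def kappa (P : MvPolynomial (Fin (ν + 1)) ℤ) (w : Fin (ν + 1) → ℕ) (j : ℕ) : ℤ :=
  ∑ p ∈ terms P with termPos P p = j, termCoeff P w p

/-- The value of `coeffs` at `ℬ = B`. -/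
noncomputable def coeffSum (P : MvPolynomial (Fin (ν + 1)) ℤ) (B : ℤ) : ℤ :=
  ∑ i ∈ P.support, (((∏ s, (i s).factorial) * (delta P - ∑ s, i s).factorial : ℕ) * P.coeff i) *
    B ^ (pos P (ν + 1) - ∑ s : Fin (ν + 1), i s * pos P s)

theorem pow_sum_eq (P : MvPolynomial (Fin (ν + 1)) ℤ) (w : Fin (ν + 1) → ℕ) (B : ℤ) :
    (1 + ∑ s, (w s : ℤ) * B ^ pos P s) ^ delta P =
      ∑ e ∈ Finset.univ.piAntidiag (delta P),
        ((Nat.multinomial Finset.univ e * ∏ s : Fin (ν + 1), w s ^ e s.succ : ℕ) : ℤ) *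
          B ^ (∑ s : Fin (ν + 1), e s.succ * pos P s) := by
  have h : (1 + ∑ s, (w s : ℤ) * B ^ pos P s) =
      ∑ t : Fin (ν + 2), (Fin.cons 1 (fun s : Fin (ν + 1) => (w s : ℤ) * B ^ pos P s) :
        Fin (ν + 2) → ℤ) t := by
    simp only [Fin.sum_univ_succ (n := ν + 1), Fin.cons_zero, Fin.cons_succ]
  rw [h, Finset.sum_pow_eq_sum_piAntidiag]
  refine Finset.sum_congr rfl fun e _ => ?_
  rw [Fin.prod_univ_succ]
  simp only [Fin.cons_zero, Fin.cons_succ, one_pow, one_mul, mul_pow, Finset.prod_mul_distrib]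
  rw [← Finset.prod_pow_eq_pow_sum]
  push_cast
  rw [mul_assoc]
  congr 2
  exact Finset.prod_congr rfl fun s _ => by rw [mul_comm, pow_mul]

theorem pow_mul_coeffSum (P : MvPolynomial (Fin (ν + 1)) ℤ) (w : Fin (ν + 1) → ℕ) (B : ℤ) :
    (1 + ∑ s, (w s : ℤ) * B ^ pos P s) ^ delta P * coeffSum P B =
      ∑ p ∈ terms P, termCoeff P w p * B ^ termPos P p := by
  rw [pow_sum_eq, coeffSum, terms, Finset.sum_mul_sum, Finset.sum_product]
  refine Finset.sum_congr rfl fun e _ => Finset.sum_congr rfl fun i _ => ?_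
  rw [termCoeff, termPos, pow_add]
  ring

theorem sum_tail_le (P : MvPolynomial (Fin (ν + 1)) ℤ) {e : Fin (ν + 2) → ℕ}
    (he : e ∈ Finset.univ.piAntidiag (delta P)) :
    e 0 + ∑ s : Fin (ν + 1), e s.succ = delta P := by
  rw [Finset.mem_piAntidiag] at he
  rw [← he.1]
  exact (Fin.sum_univ_succ e).symm

theorem sum_mul_pos_le_pos (P : MvPolynomial (Fin (ν + 1)) ℤ) {i : Fin (ν + 1) →₀ ℕ}
    (hi : i ∈ P.support) : ∑ s, i s * pos P s ≤ pos P (ν + 1) := by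
  rw [pos_succ]
  exact (sum_mul_pos_le P (sum_le_delta P hi)).trans (Nat.le_add_right _ _)

/-- The position is at most `δ n_ν + n_{ν+1}`, which is `(2 δ + 1) n_ν`. -/
theorem termPos_lt (P : MvPolynomial (Fin (ν + 1)) ℤ)
    {p : (Fin (ν + 2) → ℕ) × (Fin (ν + 1) →₀ ℕ)} (hp : p ∈ terms P) :
    termPos P p < (2 * delta P + 1) * pos P ν + 1 := by
  rw [terms, Finset.mem_product] at hp
  have h1 := sum_mul_pos_le P (e := fun s => p.1 s.succ)
    (by have := sum_tail_le P hp.1; omega)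
  have h2 := pos_succ P ν
  rw [termPos, add_mul, mul_assoc]
  omega

theorem pow_mul_coeffSum_eq_sum_kappa (P : MvPolynomial (Fin (ν + 1)) ℤ) (w : Fin (ν + 1) → ℕ)
    (B : ℤ) :
    (1 + ∑ s, (w s : ℤ) * B ^ pos P s) ^ delta P * coeffSum P B =
      ∑ j ∈ Finset.range ((2 * delta P + 1) * pos P ν + 1), kappa P w j * B ^ j := by
  rw [pow_mul_coeffSum, ← Finset.sum_fiberwise_of_maps_to (g := termPos P)
    (t := Finset.range ((2 * delta P + 1) * pos P ν + 1))
    (fun p hp => Finset.mem_range.2 (termPos_lt P hp))]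
  refine Finset.sum_congr rfl fun j _ => ?_
  rw [kappa, Finset.sum_mul]
  refine Finset.sum_congr rfl fun p hp => ?_
  rw [(Finset.mem_filter.1 hp).2]

theorem prod_factorial_mul_le (P : MvPolynomial (Fin (ν + 1)) ℤ) {i : Fin (ν + 1) →₀ ℕ}
    (hi : i ∈ P.support) :
    (∏ s, (i s).factorial) * (delta P - ∑ s, i s).factorial ≤ (delta P).factorial := by
  have h := Nat.le_of_dvd (Nat.factorial_pos _) (Nat.factorial_mul_factorial_dvd_factorial
    (sum_le_delta P hi))
  refine le_trans (Nat.mul_le_mul_right _ ?_) h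
  exact Nat.le_of_dvd (Nat.factorial_pos _) (Nat.prod_factorial_dvd_factorial_sum _ _)

theorem sum_natAbs_le (P : MvPolynomial (Fin (ν + 1)) ℤ) :
    ∑ i ∈ P.support, ((∏ s, (i s).factorial) * (delta P - ∑ s, i s).factorial) *
      (P.coeff i).natAbs ≤ (delta P).factorial * ell P := by
  rw [ell, Finset.mul_sum]
  exact Finset.sum_le_sum fun i hi => Nat.mul_le_mul_right _ (prod_factorial_mul_le P hi)

/-- The bound sums absolute values over all pairs, not only those at position `j`; the total
factors, and the multinomial expansion at `B = 1` evaluates the first factor. -/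
theorem abs_kappa_le (P : MvPolynomial (Fin (ν + 1)) ℤ) (w : Fin (ν + 1) → ℕ) (j : ℕ) :
    (kappa P w j).natAbs ≤ (1 + ∑ s, w s) ^ delta P * ((delta P).factorial * ell P) := by
  have h1 : (kappa P w j).natAbs ≤ ∑ p ∈ terms P, (termCoeff P w p).natAbs := by
    refine (Int.natAbs_sum_le _ _).trans ?_
    exact Finset.sum_le_sum_of_subset (Finset.filter_subset _ _)
  refine h1.trans (le_trans (le_of_eq ?_) (Nat.mul_le_mul_left _ (sum_natAbs_le P)))
  have h2 := pow_sum_eq P w 1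
  simp only [one_pow, mul_one] at h2
  norm_cast at h2
  rw [h2, terms, Finset.sum_mul_sum, Finset.sum_product]
  refine Finset.sum_congr rfl fun e _ => Finset.sum_congr rfl fun i _ => ?_
  simp only [termCoeff, Int.natAbs_mul, Int.natAbs_natCast]

/-- The exponent vector of the homogenization of the monomial `i`. -/
def homogExp (d : ℕ) (i : Fin (ν + 1) →₀ ℕ) : Fin (ν + 2) → ℕ := Fin.cons (d - ∑ s, i s) i

/-- All exponents are at most `δ`, hence are digits in base `δ + 1`, and the `n_s` are the powers of
that base; uniqueness of digits identifies the exponents. The remaining entry follows from the total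
`δ`. -/
theorem termPos_eq_iff (P : MvPolynomial (Fin (ν + 1)) ℤ)
    {p : (Fin (ν + 2) → ℕ) × (Fin (ν + 1) →₀ ℕ)} (hp : p ∈ terms P) :
    termPos P p = pos P (ν + 1) ↔ p.1 = homogExp (delta P) p.2 := by
  obtain ⟨e, i⟩ := p
  rw [terms, Finset.mem_product] at hp
  have h1 := sum_mul_pos_le_pos P hp.2
  have h2 := sum_tail_le P hp.1
  have h3 := sum_le_delta P hp.2
  rw [termPos]
  dsimp only at *
  constructor
  · intro h
    have h4 : ∑ s : Fin (ν + 1), e s.succ * pos P s = ∑ s, i s * pos P s := by omega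
    have lt : ∀ x : Fin (ν + 1) → ℕ, ∑ s, x s ≤ delta P → ∀ s, x s < delta P + 1 := by
      intro x hx s
      have := Finset.single_le_sum (f := x) (fun _ _ => Nat.zero_le _) (Finset.mem_univ s)
      omega
    have h5 := sum_mul_pow_injective (B := delta P + 1) (x := fun s : Fin (ν + 1) => e s.succ)
      (y := i) (lt (fun s => e s.succ) (by omega)) (lt _ h3) h4
    funext s
    refine Fin.cases ?_ (fun t => ?_) s
    · rw [homogExp, Fin.cons_zero, ← h5]
      dsimp only
      omega
    · rw [homogExp, Fin.cons_succ, ← h5]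
  · rintro rfl
    simp only [homogExp, Fin.cons_succ]
    omega

/-- The middle coefficient of `c ^ δ coeffs(ℬ)` is `δ! P(w)`. -/
theorem kappa_pos_eq (P : MvPolynomial (Fin (ν + 1)) ℤ) (w : Fin (ν + 1) → ℕ) :
    kappa P w (pos P (ν + 1)) = (delta P).factorial * eval (fun s => (w s : ℤ)) P := by
  have h : (terms P).filter (fun p => termPos P p = pos P (ν + 1)) =
      P.support.map ⟨fun i => (homogExp (delta P) i, i), fun i j hij => (Prod.ext_iff.1 hij).2⟩ := by
    ext ⟨e, i⟩
    rw [Finset.mem_filter, Finset.mem_map]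
    constructor
    · rintro ⟨h1, h2⟩
      have h3 := (termPos_eq_iff P h1).1 h2
      exact ⟨i, (Finset.mem_product.1 h1).2, Prod.ext h3.symm rfl⟩
    · rintro ⟨i', h1, h2⟩
      obtain ⟨h4, rfl⟩ : homogExp (delta P) i' = e ∧ i' = i := Prod.mk.inj h2
      have h3 : (e, i') ∈ terms P := by
        rw [terms, Finset.mem_product, Finset.mem_piAntidiag]
        refine ⟨⟨?_, by simp⟩, h1⟩
        have := sum_le_delta P h1
        rw [← h4, homogExp]
        simp only [Fin.sum_univ_succ (n := ν + 1), Fin.cons_zero, Fin.cons_succ]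
        omega
      exact ⟨h3, (termPos_eq_iff P h3).2 h4.symm⟩
  rw [kappa, h, Finset.sum_map, eval_eq', Finset.mul_sum]
  refine Finset.sum_congr rfl fun i hi => ?_
  -- The weights `i! (δ - |i|)!` in `coeffs` are the denominator of this multinomial coefficient, so
  -- every monomial ends up with the same factor `δ!`.
  have h1 := Nat.multinomial_spec (Finset.univ) (homogExp (delta P) i)
  have h2 : ∑ t, homogExp (delta P) i t = delta P := by
    have := sum_le_delta P hi
    simp only [homogExp, Fin.sum_univ_succ (n := ν + 1), Fin.cons_zero, Fin.cons_succ]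
    omega
  have h3 : ∏ t, (homogExp (delta P) i t).factorial =
      (delta P - ∑ s, i s).factorial * ∏ s, (i s).factorial := by
    simp only [homogExp, Fin.prod_univ_succ (n := ν + 1), Fin.cons_zero, Fin.cons_succ]
  rw [h2, h3] at h1
  rw [← h1, termCoeff]
  simp only [Function.Embedding.coeFn_mk, homogExp, Fin.cons_succ]
  push_cast
  ring


/-! ### Sparse numbers and masking -/

theorem pos_injective {P : MvPolynomial (Fin (ν + 1)) ℤ} (hδ : 0 < delta P) :
    Function.Injective (pos P) :=
  Nat.pow_right_injective (by omega)

theorem pos_le_pos (P : MvPolynomial (Fin (ν + 1)) ℤ) {i j : ℕ} (h : i ≤ j) :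
    pos P i ≤ pos P j :=
  Nat.pow_le_pow_right (by omega) h

/-- The digit sequence with `z i` at the position `n_{i + 1}`, and `0` elsewhere. -/
noncomputable def spread (P : MvPolynomial (Fin (ν + 1)) ℤ) (z : Fin ν → ℕ) (j : ℕ) : ℕ :=
  ∑ i : Fin ν, if pos P (i + 1) = j then z i else 0

theorem spread_pos {P : MvPolynomial (Fin (ν + 1)) ℤ} (hδ : 0 < delta P) (z : Fin ν → ℕ)
    (i : Fin ν) : spread P z (pos P (i + 1)) = z i := by
  rw [spread, Finset.sum_eq_single i]
  · simp
  · intro j _ hj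
    rw [if_neg]
    intro h
    exact hj (Fin.ext (by have := pos_injective hδ h; omega))
  · simp

theorem spread_of_ne {P : MvPolynomial (Fin (ν + 1)) ℤ} (z : Fin ν → ℕ) {j : ℕ}
    (hj : ∀ i : Fin ν, pos P (i + 1) ≠ j) : spread P z j = 0 :=
  Finset.sum_eq_zero fun i _ => if_neg (hj i)

theorem spread_lt {P : MvPolynomial (Fin (ν + 1)) ℤ} (hδ : 0 < delta P) {z : Fin ν → ℕ} {b : ℕ}
    (hb : 0 < b) (hz : ∀ i, z i < b) (j : ℕ) : spread P z j < b := by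
  by_cases h : ∃ i : Fin ν, pos P (i + 1) = j
  · obtain ⟨i, rfl⟩ := h
    rw [spread_pos hδ]
    exact hz i
  · push Not at h
    rwa [spread_of_ne z h]

theorem sum_spread (P : MvPolynomial (Fin (ν + 1)) ℤ) (z : Fin ν → ℕ) (B : ℕ) :
    ∑ j ∈ Finset.range (pos P ν + 1), spread P z j * B ^ j = ∑ i, z i * B ^ pos P (i + 1) := by
  simp only [spread, Finset.sum_mul]
  rw [Finset.sum_comm]
  refine Finset.sum_congr rfl fun i _ => ?_
  rw [Finset.sum_eq_single (pos P (i + 1))]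
  · simp
  · intro j _ hj
    rw [if_neg hj.symm, zero_mul]
  · intro h
    have := pos_le_pos P (i := i + 1) (j := ν) (by omega)
    simp at h
    omega

theorem sum_sparse_lt {P : MvPolynomial (Fin (ν + 1)) ℤ} (hδ : 0 < delta P) {z : Fin ν → ℕ}
    {b B : ℕ} (hb : 0 < b) (hbB : b ≤ B) (hz : ∀ i, z i < b) :
    ∑ i, z i * B ^ pos P (i + 1) < b * B ^ pos P ν := by
  rw [← sum_spread, Finset.sum_range_succ]
  have h1 := sum_mul_pow_lt (pos P ν) (spread P z) (B := B)
    fun j _ => (spread_lt hδ hb hz j).trans_le hbB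
  have h2 := Nat.mul_le_mul_right (B ^ pos P ν) (Nat.succ_le_of_lt (spread_lt hδ hb hz (pos P ν)))
  rw [Nat.succ_mul] at h2
  omega

open Classical in
/-- The digits of `M`, for `𝔟 = 2 ^ q` and `ℬ = 2 ^ k`. -/
noncomputable def maskDigit (P : MvPolynomial (Fin (ν + 1)) ℤ) (q k j : ℕ) : ℕ :=
  if ∃ i, 1 ≤ i ∧ i ≤ ν ∧ j = pos P i then 2 ^ k - 2 ^ q else 2 ^ k - 1

/-- The value of `M`, for `𝔟 = 2 ^ q` and `ℬ = 2 ^ k`. -/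
noncomputable def mask (P : MvPolynomial (Fin (ν + 1)) ℤ) (q k : ℕ) : ℕ :=
  ∑ j ∈ Finset.range (pos P ν + 1), maskDigit P q k j * (2 ^ k) ^ j

theorem maskDigit_lt (P : MvPolynomial (Fin (ν + 1)) ℤ) (q k j : ℕ) :
    maskDigit P q k j < 2 ^ k := by
  have h1 : 0 < 2 ^ q := by positivity
  have h2 : 0 < 2 ^ k := by positivity
  rw [maskDigit]
  split_ifs <;> omega

theorem maskDigit_pos (P : MvPolynomial (Fin (ν + 1)) ℤ) (q k : ℕ) (i : Fin ν) :
    maskDigit P q k (pos P (i + 1)) = 2 ^ k - 2 ^ q :=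
  if_pos ⟨i + 1, by omega, by omega, rfl⟩

theorem maskDigit_of_ne {P : MvPolynomial (Fin (ν + 1)) ℤ} (q k : ℕ) {j : ℕ}
    (hj : ∀ i : Fin ν, pos P (i + 1) ≠ j) : maskDigit P q k j = 2 ^ k - 1 := by
  refine if_neg ?_
  rintro ⟨i, h1, h2, rfl⟩
  obtain ⟨i, rfl⟩ : ∃ i', i = i' + 1 := ⟨i - 1, by omega⟩
  exact hj ⟨i, by omega⟩ rfl

/-- Digit by digit, the mask leaves the low `q` bits free at the positions `n_1, …, n_ν` and forces
zero at all others. -/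
theorem land_mask_eq_zero_iff {P : MvPolynomial (Fin (ν + 1)) ℤ} (hδ : 0 < delta P) {q k g : ℕ}
    (hq : q ≤ k) (hg : g < (2 ^ k) ^ (pos P ν + 1)) :
    g &&& mask P q k = 0 ↔
      ∃ z : Fin ν → ℕ, (∀ i, z i < 2 ^ q) ∧ g = ∑ i, z i * (2 ^ k) ^ pos P (i + 1) := by
  have hk : 0 < 2 ^ k := by positivity
  have hqk : 2 ^ q ≤ 2 ^ k := Nat.pow_le_pow_right (by norm_num) hq
  constructor
  · intro h
    have e := sum_digits_eq _ g hg
    rw [e, mask, sum_land_sum_eq_zero_iff k _ _ _ (fun j _ => Nat.mod_lt _ hk)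
      (fun j _ => maskDigit_lt P q k j)] at h
    refine ⟨fun i => g / (2 ^ k) ^ pos P (i + 1) % 2 ^ k, fun i => ?_, ?_⟩
    · have h1 := h (pos P (i + 1)) (by
        have := pos_le_pos P (i := i + 1) (j := ν) (by omega)
        omega)
      rwa [maskDigit_pos, land_two_pow_sub_two_pow_eq_zero hq (Nat.mod_lt _ hk)] at h1
    · rw [← sum_spread]
      conv_lhs => rw [e]
      refine Finset.sum_congr rfl fun j hj => ?_
      congr 1
      by_cases hi : ∃ i : Fin ν, pos P (i + 1) = j
      · obtain ⟨i, rfl⟩ := hi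
        rw [spread_pos hδ]
      · push Not at hi
        have h1 := h j (Finset.mem_range.1 hj)
        rw [maskDigit_of_ne q k hi, land_two_pow_sub_one_eq_zero (Nat.mod_lt _ hk)] at h1
        rw [spread_of_ne _ hi, h1]
  · rintro ⟨z, hz, rfl⟩
    have hlt : ∀ j, spread P z j < 2 ^ k := fun j =>
      (spread_lt hδ (by positivity) hz j).trans_le hqk
    rw [← sum_spread, mask, sum_land_sum_eq_zero_iff k _ _ _ (fun j _ => hlt j)
      (fun j _ => maskDigit_lt P q k j)]
    intro j _
    by_cases hi : ∃ i : Fin ν, pos P (i + 1) = j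
    · obtain ⟨i, rfl⟩ := hi
      rw [maskDigit_pos, land_two_pow_sub_two_pow_eq_zero hq (hlt _), spread_pos hδ]
      exact hz i
    · push Not at hi
      rw [spread_of_ne _ hi, Nat.zero_and]

/-! ### Size of the constants -/

theorem ell_pos {P : MvPolynomial (Fin (ν + 1)) ℤ} (hP : P ≠ 0) : 0 < ell P := by
  obtain ⟨i, hi⟩ := Finset.nonempty_iff_ne_empty.2 (support_eq_empty.not.2 hP)
  refine Finset.sum_pos' (fun _ _ => Nat.zero_le _) ⟨i, hi, ?_⟩
  exact Int.natAbs_pos.2 (mem_support_iff.1 hi)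

theorem lt_beta (P : MvPolynomial (Fin (ν + 1)) ℤ) :
    2 * (delta P).factorial * ell P * (ν + 3) ^ delta P < beta P :=
  Nat.sInf_mem (s := {n : ℕ | 2 * (delta P).factorial * ell P * (ν + 3) ^ delta P < 4 ^ n})
    ⟨_, Nat.lt_pow_self (by norm_num)⟩

theorem r_pos {P : MvPolynomial (Fin (ν + 1)) ℤ} (hP : P ≠ 0) : 0 < r P := by
  by_contra h
  have h1 := lt_beta P
  have h2 : 0 < 2 * (delta P).factorial * ell P * (ν + 3) ^ delta P := by
    have := ell_pos hP
    have := Nat.factorial_pos (delta P)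
    positivity
  rw [beta, show r P = 0 by omega] at h1
  omega

theorem natAbs_coeffSum_le (P : MvPolynomial (Fin (ν + 1)) ℤ) {B : ℕ} (hB : 0 < B) :
    (coeffSum P B).natAbs ≤ (delta P).factorial * ell P * B ^ pos P (ν + 1) := by
  refine (Int.natAbs_sum_le _ _).trans ?_
  refine le_trans (Finset.sum_le_sum fun i _ => ?_)
    (le_trans (Finset.sum_mul _ _ _).ge (Nat.mul_le_mul_right _ (sum_natAbs_le P)))
  rw [Int.natAbs_mul, Int.natAbs_mul, Int.natAbs_natCast, Int.natAbs_pow, Int.natAbs_natCast]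
  exact Nat.mul_le_mul_left _ (Nat.pow_le_pow_right hB (Nat.sub_le _ _))

/-- This crude bound uses only the size of `c`, not the sparseness of `g`, so it gives `𝒦 ≥ 0` for
every admissible `g`. The constant `3` is absorbed by `ν + 3` in the choice of `β`. -/
theorem two_mul_natAbs_lt (P : MvPolynomial (Fin (ν + 1)) ℤ) {b B c : ℕ} (hb : 0 < b)
    (hB : beta P * b ^ delta P = B) (hc : c ≤ 3 * b * B ^ pos P ν) :
    2 * ((c : ℤ) ^ delta P * coeffSum P B).natAbs <
      B ^ ((2 * delta P + 1) * pos P ν + 1) := by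
  have hB0 : 0 < B := by
    rw [← hB]
    have := (Nat.zero_le _).trans_lt (lt_beta P)
    positivity
  have h1 : (3 : ℕ) ^ delta P ≤ (ν + 3) ^ delta P := Nat.pow_le_pow_left (by omega) _
  have h2 : 2 * (delta P).factorial * ell P * 3 ^ delta P < beta P :=
    (Nat.mul_le_mul_left _ h1).trans_lt (lt_beta P)
  have h3 : B ^ ((2 * delta P + 1) * pos P ν + 1) =
      beta P * (b ^ delta P * (B ^ (pos P ν * delta P) * B ^ pos P (ν + 1))) := by
    rw [pos_succ, pow_succ, ← pow_add, ← mul_assoc (beta P), hB, mul_comm]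
    congr 2
    ring
  rw [Int.natAbs_mul, Int.natAbs_pow, Int.natAbs_natCast, h3]
  calc 2 * (c ^ delta P * (coeffSum P B).natAbs)
      ≤ 2 * ((3 * b * B ^ pos P ν) ^ delta P *
          ((delta P).factorial * ell P * B ^ pos P (ν + 1))) := by
        gcongr
        exact natAbs_coeffSum_le P hB0
    _ = (2 * (delta P).factorial * ell P * 3 ^ delta P) *
          (b ^ delta P * (B ^ (pos P ν * delta P) * B ^ pos P (ν + 1))) := by
        rw [mul_pow, mul_pow, ← pow_mul]
        ring
    _ < _ := Nat.mul_lt_mul_of_pos_right h2 (by positivity)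

theorem two_mul_natAbs_kappa_lt (P : MvPolynomial (Fin (ν + 1)) ℤ) {b : ℕ}
    {w : Fin (ν + 1) → ℕ} (hb : 0 < b) (hw : ∀ s, w s < b) (j : ℕ) :
    2 * (kappa P w j).natAbs < beta P * b ^ delta P := by
  have h1 : 1 + ∑ s, w s ≤ (ν + 3) * b := by
    have : ∑ s, w s ≤ (ν + 1) * b := by
      refine (Finset.sum_le_sum fun s _ => (hw s).le).trans ?_
      simp
    rw [show ν + 3 = ν + 1 + 2 by ring, add_mul]
    omega
  calc 2 * (kappa P w j).natAbs
      ≤ 2 * (((ν + 3) * b) ^ delta P * ((delta P).factorial * ell P)) := by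
        refine Nat.mul_le_mul_left _ ((abs_kappa_le P w j).trans ?_)
        gcongr
    _ = 2 * (delta P).factorial * ell P * (ν + 3) ^ delta P * b ^ delta P := by
        rw [mul_pow]
        ring
    _ < _ := Nat.mul_lt_mul_of_pos_right (lt_beta P) (by positivity)

/-- If `g` is sparse, then `2𝒦` avoids the bits of `(ℬ - 2) ℬ ^ n_{ν + 1}` exactly when `P`
vanishes at the digits of `g`. -/
theorem two_mul_land_eq_zero_iff_PVal {P : MvPolynomial (Fin (ν + 1)) ℤ} {q k a g K : ℕ}
    (hk : 0 < k) (hB : beta P * (2 ^ q) ^ delta P = 2 ^ k) (ha : a < 2 ^ q) {z : Fin ν → ℕ}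
    (hz : ∀ i, z i < 2 ^ q) (hg : g = ∑ i, z i * (2 ^ k) ^ pos P (i + 1))
    (hK : (K : ℤ) = (1 + a * (2 ^ k : ℕ) + g : ℤ) ^ delta P * coeffSum P (2 ^ k : ℕ) +
      (∑ j ∈ Finset.range ((2 * delta P + 1) * pos P ν + 1), 2 ^ (k - 1) * (2 ^ k) ^ j : ℕ)) :
    (2 * K) &&& ((2 ^ k - 2) * (2 ^ k) ^ pos P (ν + 1)) = 0 ↔ PVal P a z = 0 := by
  set w : Fin (ν + 1) → ℕ := Fin.cons a z with hw_def
  have hw : ∀ s, w s < 2 ^ q := fun s => Fin.cases ha hz s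
  have hkk : 2 ^ k = 2 * 2 ^ (k - 1) := by rw [← pow_succ']; congr 1; omega
  have hκ : ∀ j, (kappa P w j).natAbs < 2 ^ (k - 1) := fun j => by
    have := two_mul_natAbs_kappa_lt P (by positivity) hw j
    omega
  -- Since `n_0 = 1`, the term `a ℬ` is the one at position `n_0`.
  have hc : (1 + a * (2 ^ k : ℕ) + g : ℤ) = 1 + ∑ s, (w s : ℤ) * ((2 ^ k : ℕ) : ℤ) ^ pos P s := by
    rw [Fin.sum_univ_succ, hg, ← add_assoc]
    simp [hw_def, pos]
  have hKsum : K = ∑ j ∈ Finset.range ((2 * delta P + 1) * pos P ν + 1),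
      (kappa P w j + 2 ^ (k - 1)).toNat * (2 ^ k) ^ j := by
    zify
    rw [hK, hc, pow_mul_coeffSum_eq_sum_kappa]
    push_cast
    rw [← Finset.sum_add_distrib]
    refine Finset.sum_congr rfl fun j _ => ?_
    have h1 := hκ j
    rw [Int.toNat_of_nonneg (by zify at h1; have := neg_abs_le (kappa P w j); linarith)]
    ring
  have hpos : pos P (ν + 1) < (2 * delta P + 1) * pos P ν + 1 := by
    have := pos_succ P ν
    rw [add_mul, mul_assoc]
    omega
  rw [hKsum, two_mul_land_eq_zero_iff hk hpos]
  · have e : PVal P a z = eval (fun s => (w s : ℤ)) P := by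
      rw [PVal]
      congr 1
      congr 1
      funext s
      exact Fin.cases rfl (fun _ => rfl) s
    have h1 := hκ (pos P (ν + 1))
    have h2 : kappa P w (pos P (ν + 1)) = 0 ↔ PVal P a z = 0 := by
      rw [kappa_pos_eq, e, mul_eq_zero]
      simp [Nat.factorial_ne_zero]
    rw [← h2, ← Int.natCast_dvd_natCast]
    zify at h1
    have h3 := neg_abs_le (kappa P w (pos P (ν + 1)))
    rw [Int.toNat_of_nonneg (by linarith)]
    push_cast
    -- The shift by `ℬ / 2` is invisible modulo `ℬ / 2`, and a multiple of `ℬ / 2` of smaller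
    -- absolute value is zero.
    rw [dvd_add_self_right]
    constructor
    · intro h
      exact Int.eq_zero_of_abs_lt_dvd h h1
    · intro h
      rw [h]
      exact dvd_zero _
  · intro j _
    have h1 := hκ j
    have h2 : ((2 ^ (k - 1) : ℕ) : ℤ) = 2 ^ (k - 1) := by push_cast; rfl
    rw [← h2]
    omega


/-! ### The values of the polynomials -/

theorem eval_incl (p : MvPolynomial (Fin 2) ℤ) (a f g : ℤ) :
    eval ![a, f, g] (incl p) = eval ![a, f] p := by
  rw [incl, eval_rename]
  congr 2
  funext i
  fin_cases i <;> rfl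

theorem bVal_eq (a f : ℕ) : bVal a f = 1 + 3 * (2 * a + 1) * f := by
  simp [bVal, b]

theorem eval_B (P : MvPolynomial (Fin (ν + 1)) ℤ) (a f : ℕ) :
    eval ![(a : ℤ), (f : ℤ)] (B P) = beta P * bVal a f ^ delta P := by
  simp [B, bVal]

theorem eval_halfB (P : MvPolynomial (Fin (ν + 1)) ℤ) (a f : ℕ) :
    eval ![(a : ℤ), (f : ℤ)] (halfB P) = (beta P / 2 : ℕ) * bVal a f ^ delta P := by
  simp [halfB, bVal]

theorem eval_coeffs (P : MvPolynomial (Fin (ν + 1)) ℤ) (v : Fin 2 → ℤ) :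
    eval v (coeffs P) = coeffSum P (eval v (B P)) := by
  rw [coeffs, coeffSum, map_sum]
  refine Finset.sum_congr rfl fun i _ => ?_
  rw [map_mul, map_pow, eval_C]

theorem eval_M (P : MvPolynomial (Fin (ν + 1)) ℤ) {v : Fin 2 → ℤ} {q k : ℕ} (hq : q ≤ k)
    (hb : eval v b = 2 ^ q) (hB : eval v (B P) = 2 ^ k) : eval v (M P) = mask P q k := by
  have hqk : 2 ^ q ≤ 2 ^ k := Nat.pow_le_pow_right (by norm_num) hq
  have hk : 1 ≤ 2 ^ k := Nat.one_le_two_pow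
  rw [M, mask, map_sum]
  push_cast
  refine Finset.sum_congr rfl fun j _ => ?_
  rw [map_mul, map_pow, hB, maskDigit]
  congr 1
  split_ifs
  · rw [map_sub, hB, hb]
    push_cast [hqk]
    rfl
  · rw [map_sub, hB, map_one]
    push_cast [hk]
    rfl

theorem XVal_eq (P : MvPolynomial (Fin (ν + 1)) ℤ) {a f : ℕ} (g : ℕ) {q k : ℕ} (hq : q ≤ k)
    (hb : bVal a f = 2 ^ q) (hB : eval ![(a : ℤ), (f : ℤ)] (B P) = 2 ^ k)
    (hH : eval ![(a : ℤ), (f : ℤ)] (halfB P) = 2 ^ (k - 1)) {N₀ N T : ℤ} {K : ℤ}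
    (hN₀ : N₀ = (2 ^ k) ^ (pos P ν + 1))
    (hN : N = N₀ * (4 * (2 ^ k) ^ ((2 * delta P + 1) * pos P ν + 1)))
    (hT : T = mask P q k + (2 ^ k - 2) * (2 ^ k) ^ pos P (ν + 1) * N₀)
    (hK : K = (1 + a * (2 ^ k : ℕ) + g : ℤ) ^ delta P * coeffSum P (2 ^ k : ℕ) +
      (∑ j ∈ Finset.range ((2 * delta P + 1) * pos P ν + 1), 2 ^ (k - 1) * (2 ^ k) ^ j : ℕ)) :
    XVal P a f g = (N - 1) * ((g + 2 * K * N₀ + T + 1) * N + T + 1) := by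
  have h0 : eval ![(a : ℤ), (f : ℤ)] (N0 P) = N₀ := by rw [N0, map_pow, hB, hN₀]
  have h1 : eval ![(a : ℤ), (f : ℤ)] (Coding.N P) = N := by
    rw [Coding.N, N1, map_mul, map_mul, map_pow, hB, h0, hN, map_ofNat]
  have h2 : eval ![(a : ℤ), (f : ℤ)] (Coding.T P) = T := by
    rw [Coding.T, map_add, map_mul, map_mul, map_sub, map_pow, hB, h0, hT, map_ofNat,
      eval_M P hq hb hB]
  have h3 : eval ![(a : ℤ), (f : ℤ), (g : ℤ)] (Coding.K P) = K := by
    rw [Coding.K, map_add, map_mul, map_pow, eval_incl, eval_coeffs, hB, c, hK, map_sum]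
    simp only [map_add, map_mul, map_one, map_pow, eval_incl, hB, hH, eval_X]
    push_cast
    rfl
  rw [XVal, XX, R, S]
  simp only [map_add, map_sub, map_mul, map_one, eval_incl, h0, h1, h2, h3, eval_X, map_ofNat]
  rfl

/-- The divisibility condition, expressed by binary digits. -/
theorem XVal_nonneg_and_binomCond_iff {P : MvPolynomial (Fin (ν + 1)) ℤ} (hδ : 0 < delta P)
    {a f g q k : ℕ} (hP : P ≠ 0) (ha : a < 2 ^ q) (hb : bVal a f = 2 ^ q)
    (hB : beta P * (2 ^ q) ^ delta P = 2 ^ k)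
    (hg : g < 2 * 2 ^ q * (2 ^ k) ^ pos P ν) :
    0 ≤ XVal P a f g ∧ ∃ K : ℕ,
      (K : ℤ) = (1 + a * (2 ^ k : ℕ) + g : ℤ) ^ delta P * coeffSum P (2 ^ k : ℕ) +
        (∑ j ∈ Finset.range ((2 * delta P + 1) * pos P ν + 1), 2 ^ (k - 1) * (2 ^ k) ^ j : ℕ) ∧
      (BinomCond P a f g ↔ g &&& mask P q k = 0 ∧
        (2 * K) &&& ((2 ^ k - 2) * (2 ^ k) ^ pos P (ν + 1)) = 0) := by
  set D := (2 * delta P + 1) * pos P ν with hD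
  have hq0 : 0 < 2 ^ q := by positivity
  obtain ⟨m, hm⟩ : ∃ m, r P = m + 1 := ⟨r P - 1, by have := r_pos hP; omega⟩
  have hβ : beta P = 4 * 4 ^ m := by rw [beta, hm, pow_succ']
  have hkk : k = 2 * (m + 1) + q * delta P := by
    have h : (2 : ℕ) ^ k = 2 ^ (2 * (m + 1) + q * delta P) := by
      rw [← hB, beta, hm, pow_add (2 : ℕ), pow_mul 2 2, pow_mul 2 q]
      norm_num
    exact Nat.pow_right_injective le_rfl h
  have hqd : q ≤ q * delta P := Nat.le_mul_of_pos_right q hδ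
  have hqk : q + 1 ≤ k := by omega
  have h2k : 2 ^ k = 2 * 2 ^ (k - 1) := by rw [← pow_succ']; congr 1; omega
  have h2b : 2 * 2 ^ q ≤ 2 ^ k := by
    rw [← pow_succ']; exact Nat.pow_le_pow_right (by norm_num) hqk
  have hevB : eval ![(a : ℤ), (f : ℤ)] (B P) = 2 ^ k := by
    rw [eval_B, hb]
    exact_mod_cast hB
  have hevH : eval ![(a : ℤ), (f : ℤ)] (halfB P) = 2 ^ (k - 1) := by
    rw [eval_halfB, hb, hβ, show 4 * 4 ^ m / 2 = 2 * 4 ^ m by omega]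
    have : 2 * (2 * 4 ^ m * (2 ^ q) ^ delta P) = 2 * 2 ^ (k - 1) := by
      rw [← h2k, ← hB, hβ]
      ring
    exact_mod_cast Nat.eq_of_mul_eq_mul_left two_pos this
  set G := ∑ j ∈ Finset.range (D + 1), 2 ^ (k - 1) * (2 ^ k) ^ j with hG
  have hG1 : G < (2 ^ k) ^ (D + 1) :=
    sum_mul_pow_lt _ (fun _ => 2 ^ (k - 1)) fun _ _ => by
      have : 0 < 2 ^ (k - 1) := by positivity
      omega
  have hG2 : (2 ^ k) ^ (D + 1) ≤ 2 * G := by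
    rw [hG, Finset.sum_range_succ, pow_succ, mul_add, ← mul_assoc 2 (2 ^ (k - 1)), ← h2k,
      mul_comm]
    exact Nat.le_add_left _ _
  set κ : ℤ := (1 + a * (2 ^ k : ℕ) + g : ℤ) ^ delta P * coeffSum P (2 ^ k : ℕ) with hκ
  have hκ1 : 2 * κ.natAbs < (2 ^ k) ^ (D + 1) := by
    -- Of the factor `3`, two parts come from the doubled range of `g` and one from `1 + a ℬ ≤ (a +
    -- 1) ℬ`.
    have hc : 1 + a * 2 ^ k + g ≤ 3 * 2 ^ q * (2 ^ k) ^ pos P ν := by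
      have h1 : (a + 1) * 2 ^ k ≤ 2 ^ q * (2 ^ k) ^ pos P ν := by
        refine Nat.mul_le_mul ha ?_
        exact Nat.le_self_pow (by unfold pos; positivity) _
      have h2 : 1 ≤ 2 ^ k := Nat.one_le_two_pow
      rw [add_mul, one_mul] at h1
      rw [mul_assoc] at hg ⊢
      omega
    have := two_mul_natAbs_lt P hq0 hB hc
    push_cast at this
    simpa [hκ] using this
  -- The top term of `2 G` alone is `ℬ ^ (D + 1)`, which exceeds `2 |κ|`; so truncation to `ℕ` loses
  -- nothing.
  obtain ⟨K, hK⟩ : ∃ K : ℕ, (K : ℤ) = κ + G := ⟨(κ + G).toNat, by omega⟩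
  -- `2 |κ|` is below `ℬ ^ (D + 1)` and `2 G` below twice that; the factor `4` in `N₁` leaves room
  -- for both.
  have hKlt : 2 * K + 1 ≤ 4 * (2 ^ k) ^ (D + 1) := by omega
  have hgN : g < (2 ^ k) ^ (pos P ν + 1) := by
    refine hg.trans_le ?_
    rw [pow_succ']
    exact Nat.mul_le_mul_right _ h2b
  set N₀ := (2 ^ k) ^ (pos P ν + 1) with hN₀
  set n := k * (pos P ν + 1) + (2 + k * (D + 1)) with hn
  have hN : 2 ^ n = N₀ * (4 * (2 ^ k) ^ (D + 1)) := by
    rw [hn, hN₀, pow_add, pow_add, pow_mul, pow_mul]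
    norm_num
  set T := mask P q k + N₀ * ((2 ^ k - 2) * (2 ^ k) ^ pos P (ν + 1)) with hT
  set S := g + N₀ * (2 * K) with hS
  have hSlt : S < 2 ^ n := by
    have h1 := Nat.mul_le_mul_left N₀ hKlt
    rw [hN]
    rw [mul_add] at h1
    omega
  have hMlt : mask P q k < N₀ := sum_mul_pow_lt _ _ fun j _ => maskDigit_lt P q k j
  have hTlt : T < 2 ^ n := by
    have h1 : (2 ^ k - 2) * (2 ^ k) ^ pos P (ν + 1) + 1 ≤ 4 * (2 ^ k) ^ (D + 1) := by
      have h2 : (2 ^ k) ^ (pos P (ν + 1) + 1) ≤ (2 ^ k) ^ (D + 1) := by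
        refine Nat.pow_le_pow_right (by positivity) ?_
        have := pos_succ P ν
        rw [hD, add_mul, mul_assoc]
        omega
      have h3 : (2 ^ k - 2) * (2 ^ k) ^ pos P (ν + 1) ≤ 2 ^ k * (2 ^ k) ^ pos P (ν + 1) :=
        Nat.mul_le_mul_right _ (Nat.sub_le _ _)
      rw [← pow_succ'] at h3
      have h4 : 0 < (2 ^ k) ^ (D + 1) := by positivity
      omega
    have h2 := Nat.mul_le_mul_left N₀ h1
    rw [hN]
    rw [mul_add] at h2
    omega
  have hX : XVal P a f g =
      (((2 ^ n - 1 - T) + 2 ^ n * ((2 ^ n - 1 - S) + 2 ^ n * (S + T)) : ℕ) : ℤ) := by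
    have hcast : ∀ x, x < 2 ^ n → ((2 ^ n - 1 - x : ℕ) : ℤ) = 2 ^ n - 1 - x := by
      intro x hx
      have : ((2 ^ n : ℕ) : ℤ) = 2 ^ n := by push_cast; rfl
      rw [← this]
      omega
    have h2le : 2 ≤ 2 ^ k := by omega
    rw [XVal_eq P g (by omega) hb hevB hevH (N₀ := N₀) (N := 2 ^ n) (T := T) (K := K)
      (by rw [hN₀]; push_cast; rfl) (by exact_mod_cast hN)
      (by rw [hT]; push_cast [h2le]; ring) hK]
    clear_value S T
    rw [Nat.cast_add, Nat.cast_mul, Nat.cast_add, Nat.cast_mul, hcast T hTlt, hcast S hSlt, hS]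
    push_cast
    ring
  refine ⟨by rw [hX]; exact Int.natCast_nonneg _, K, hK, ?_⟩
  have hY : YVal P a f = (((2 ^ n) ^ 2 : ℕ) : ℤ) := by
    rw [YVal, Y, Coding.N, N0, N1]
    simp only [map_pow, map_mul, hevB, map_ofNat]
    rw [hN, hN₀]
    push_cast
    rfl
  rw [BinomCond, hY, hX, Int.natCast_dvd_natCast, Int.toNat_natCast,
    sq_dvd_choose_iff n S T hSlt hTlt, hS, hT, hN₀, ← pow_mul]
  rw [hN₀, ← pow_mul] at hMlt hgN
  exact land_add_two_pow_mul_eq_zero _ _ _ hgN hMlt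

end Coding

/-! ### Proof of the Coding Theorem -/

theorem mainTheorem4 {ν : ℕ} (P : MvPolynomial (Fin (ν + 1)) ℤ) (hδ : 0 < P.totalDegree)
    (a f : ℕ) (hf : 0 < f) (hb : ∃ k : ℕ, Coding.bVal a f = 2 ^ k) :
    (∀ g : ℕ, (g : ℤ) < 2 * Coding.gamma P * Coding.bVal a f ^ Coding.alpha P →
      0 ≤ Coding.XVal P a f g) ∧
    ((∃ z : Fin ν → ℕ, z ≠ 0 ∧ (∀ i, (z i : ℤ) < Coding.bVal a f) ∧ Coding.PVal P a z = 0) ↔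
      ∃ g : ℕ, Coding.bVal a f ≤ g ∧
        (g : ℤ) < Coding.gamma P * Coding.bVal a f ^ Coding.alpha P ∧
        Coding.BinomCond P a f g) ∧
    ((∃ g : ℕ, (g : ℤ) < 2 * Coding.gamma P * Coding.bVal a f ^ Coding.alpha P ∧
        Coding.BinomCond P a f g) →
      ∃ z : Fin ν → ℕ, (∀ i, (z i : ℤ) < Coding.bVal a f) ∧ Coding.PVal P a z = 0) := by
  obtain ⟨q, hq⟩ := hb
  change 0 < Coding.delta P at hδ
  have hP : P ≠ 0 := by
    rintro rfl
    simp [Coding.delta] at hδ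
  have ha : a < 2 ^ q := by
    zify
    rw [← hq, Coding.bVal_eq]
    zify at hf
    nlinarith [Int.natCast_nonneg a]
  obtain ⟨k, hk⟩ : ∃ k, Coding.beta P * (2 ^ q) ^ Coding.delta P = 2 ^ k := by
    refine ⟨2 * Coding.r P + q * Coding.delta P, ?_⟩
    rw [Coding.beta, pow_add, pow_mul, pow_mul]
    norm_num
  have hqk : q + 1 ≤ k := by
    have h1 := Coding.r_pos hP
    have h2 : (2 : ℕ) ^ (q + 1) ≤ 2 ^ k := by
      rw [← hk, pow_succ, mul_comm]
      refine Nat.mul_le_mul ?_ (Nat.le_self_pow hδ.ne' _)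
      calc 2 ≤ 4 ^ 1 := by norm_num
        _ ≤ _ := Nat.pow_le_pow_right (by norm_num) h1
    exact (Nat.pow_le_pow_iff_right one_lt_two).1 h2
  have hbound : Coding.gamma P * (2 ^ q) ^ Coding.alpha P = 2 ^ q * (2 ^ k) ^ Coding.pos P ν := by
    rw [← hk, Coding.gamma, Coding.alpha, mul_pow, pow_succ, pow_mul]
    ring
  have hcast : ∀ g : ℕ, (g : ℤ) < Coding.gamma P * Coding.bVal a f ^ Coding.alpha P ↔
      g < 2 ^ q * (2 ^ k) ^ Coding.pos P ν := by
    intro g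
    rw [hq, ← hbound]
    norm_cast
  have hcast2 : ∀ g : ℕ, (g : ℤ) < 2 * Coding.gamma P * Coding.bVal a f ^ Coding.alpha P ↔
      g < 2 * 2 ^ q * (2 ^ k) ^ Coding.pos P ν := by
    intro g
    rw [hq, mul_assoc 2 (2 ^ q), ← hbound, ← mul_assoc]
    norm_cast
  have hz_cast : ∀ z : Fin ν → ℕ, (∀ i, (z i : ℤ) < Coding.bVal a f) ↔ ∀ i, z i < 2 ^ q := by
    intro z
    rw [hq]
    norm_cast
  have hlt : (2 ^ q : ℕ) ≤ 2 ^ k := Nat.pow_le_pow_right (by norm_num) (by omega)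
  -- The doubled range is harmless because `2 𝔟 ≤ ℬ` keeps `g` below `N₀`. All the claims about
  -- divisibility follow from this equivalence.
  have key : ∀ g, g < 2 * 2 ^ q * (2 ^ k) ^ Coding.pos P ν → (Coding.BinomCond P a f g ↔
      ∃ z : Fin ν → ℕ, (∀ i, z i < 2 ^ q) ∧ g = ∑ i, z i * (2 ^ k) ^ Coding.pos P (i + 1) ∧
        Coding.PVal P a z = 0) := by
    intro g hg
    obtain ⟨-, K, hK, h⟩ := Coding.XVal_nonneg_and_binomCond_iff hδ hP ha hq hk hg
    have hg' : g < (2 ^ k) ^ (Coding.pos P ν + 1) := by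
      refine hg.trans_le ?_
      rw [pow_succ', ← pow_succ']
      exact Nat.mul_le_mul_right _ (Nat.pow_le_pow_right (by norm_num) hqk)
    rw [h, Coding.land_mask_eq_zero_iff hδ (by omega) hg']
    constructor
    · rintro ⟨⟨z, hz, hgz⟩, h2⟩
      exact ⟨z, hz, hgz,
        (Coding.two_mul_land_eq_zero_iff_PVal (by omega) hk ha hz hgz hK).1 h2⟩
    · rintro ⟨z, hz, hgz, h2⟩
      exact ⟨⟨z, hz, hgz⟩,
        (Coding.two_mul_land_eq_zero_iff_PVal (by omega) hk ha hz hgz hK).2 h2⟩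
  refine ⟨fun g hg => ?_, ⟨?_, ?_⟩, ?_⟩
  · exact (Coding.XVal_nonneg_and_binomCond_iff hδ hP ha hq hk ((hcast2 g).1 hg)).1
  · rintro ⟨z, hz0, hz, hPz⟩
    rw [hz_cast] at hz
    have hg := Coding.sum_sparse_lt hδ (by positivity) hlt hz
    refine ⟨_, ?_, (hcast _).2 hg, (key _ ?_).2 ⟨z, hz, rfl, hPz⟩⟩
    · obtain ⟨i, hi⟩ := Function.ne_iff.1 hz0
      rw [hq]
      -- A single nonzero `z_i` already gives `g ≥ ℬ ≥ 𝔟`, whereas `z = 0` gives `g = 0`; the lower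
      -- bound on `g` thus expresses that `z` is nonzero.
      have h1 : 2 ^ q ≤ z i * (2 ^ k) ^ Coding.pos P (i + 1) := by
        refine hlt.trans ((Nat.le_self_pow ?_ _).trans
          (Nat.le_mul_of_pos_left _ (Nat.pos_of_ne_zero hi)))
        unfold Coding.pos
        positivity
      have h2 := h1.trans (Finset.single_le_sum
        (f := fun i : Fin ν => z i * (2 ^ k) ^ Coding.pos P (i + 1))
        (fun _ _ => Nat.zero_le _) (Finset.mem_univ i))
      exact_mod_cast h2
    · refine hg.trans_le ?_
      rw [mul_assoc]
      exact Nat.le_mul_of_pos_left _ two_pos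
  · rintro ⟨g, hg1, hg2, hg3⟩
    rw [hcast] at hg2
    obtain ⟨z, hz, rfl, hPz⟩ := (key g (by rw [mul_assoc]; omega)).1 hg3
    refine ⟨z, ?_, (hz_cast z).2 hz, hPz⟩
    rintro rfl
    rw [hq] at hg1
    have : (0 : ℤ) < 2 ^ q := by positivity
    simp at hg1
    omega
  · rintro ⟨g, hg1, hg2⟩
    obtain ⟨z, hz, -, hPz⟩ := (key g ((hcast2 g).1 hg1)).1 hg2
    exact ⟨z, (hz_cast z).2 hz, hPz⟩
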